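/- **Conventions.** A positively ordered monoid is a commutative monoid $S$ with a partial order such that $0\le x$ for all $x$ and $x\le y$, $x'\le y'$ imply $x+x'\le y+y'$. Write $x\ll y$ if for every increasing sequence $(z_n)_n$ with a supremum $\sup_n z_n\ge y$ there is $n$ with $x\le z_n$. A *$\mathrm{Cu}$-semigroup* is a positively ordered monoid such that (O1) every increasing sequence has a supremum; (O2) every element is the supremum of a $\ll$-increasing sequence; (O3) $x'\ll x$ and $y'\ll y$ imply $x'+y'\ll x+y$; (O4) $\sup_n(x_n+y_n)=\sup_n x_n+\sup_n y_n$ for increasing sequences $(x_n)_n,(y_n)_n$. A *generalized $\mathrm{Cu}$-morphism* is an order-preserving monoid morphism between $\mathrm{Cu}$-semigroups that preserves suprema of increasing sequences; a *$\mathrm{Cu}$-morphism* is a generalized $\mathrm{Cu}$-morphism that also preserves $\ll$. The monoid $[0,\infty]$, with its usual order and addition, is a $\mathrm{Cu}$-semigroup, and $\otimes$ is the tensor product of $\mathrm{Cu}$-semigroups of Antoine, Perera and Thiel, that is, the $\mathrm{Cu}$-completion of the tensor product of positively ordered monoids with the auxiliary relation induced by $\ll$ in both factors. A generalized $\mathrm{Cu}$-morphism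 $\varphi\colon S\to T$ is * *almost unperforated* if $\varphi(x)\le\varphi(y)$ whenever $x,y\in S$ satisfy $(m+1)x\le my$ for some $m\in\mathbb N$; * *almost divisible* if for all $k\in\mathbb N$ and $x',x\in S$ with $x'\ll x$ there is $z\in T$ such that $kz\le\varphi(x)$ and $\varphi(x')\le(k+1)z$; * *soft* if every $y\in\varphi(S)$ is strongly soft, that is, for every $y'\in T$ with $y'\ll y$ there is $t\in T$ such that $y'+t\le y\le\infty t$, where $\infty t=\sup_n nt$. **Theorem.** Let $S_1,S_2,T$ be $\mathrm{Cu}$-semigroups, and let $\varphi_1\colon S_1\to S_2$ and $\varphi_2\colon S_2\to T$ be generalized $\mathrm{Cu}$-morphisms. Assume that $\varphi_1$ is soft and almost divisible, and that $\varphi_2$ is almost unperforated. Then there exists a generalized $\mathrm{Cu}$-morphism $\gamma\colon S_1\otimes[0,\infty]\to T$ such that $\gamma(x\otimes 1)=\varphi_2(\varphi_1(x))$ for every $x\in S_1$. If moreover $\varphi_1$ and $\varphi_2$ are $\mathrm{Cu}$-morphisms, then there exists a $\mathrm{Cu}$-morphism $\gamma\colon S_1\otimes[0,\infty]\to T$ such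 that $\gamma(x\otimes 1)=\varphi_2(\varphi_1(x))$ for every $x\in S_1$. -/

import Mathlib

open scoped ENNReal

namespace Cu

/-! ### Cu-semigroups -/

/-- The (sequential) compact containment relation `x ≪ y`: whenever an increasing sequence has a
supremum that dominates `y`, some member of the sequence dominates `x`. -/
def WayBelow {S : Type*} [PartialOrder S] (x y : S) : Prop :=
  ∀ (z : ℕ → S) (s : S), Monotone z → IsLUB (Set.range z) s → y ≤ s → ∃ n, x ≤ z n

/-- Abstract Cuntz semigroups: positively ordered commutative monoids that satisfy the
axioms (O1)-(O4). -/
class IsCuSemigroup (S : Type*) [AddCommMonoid S] [PartialOrder S] : Prop where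
  /-- the order is compatible with addition -/
  add_le_add' : ∀ a b c d : S, a ≤ b → c ≤ d → a + c ≤ b + d
  /-- the order is positive -/
  zero_le' : ∀ a : S, 0 ≤ a
  /-- (O1) increasing sequences have suprema -/
  O1 : ∀ x : ℕ → S, Monotone x → ∃ s, IsLUB (Set.range x) s
  /-- (O2) every element is the supremum of a `≪`-increasing sequence -/
  O2 : ∀ x : S, ∃ u : ℕ → S, (∀ n, WayBelow (u n) (u (n + 1))) ∧ IsLUB (Set.range u) x
  /-- (O3) `≪` is compatible with addition -/
  O3 : ∀ x' x y' y : S, WayBelow x' x → WayBelow y' y → WayBelow (x' + y') (x + y)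
  /-- (O4) suprema of increasing sequences are compatible with addition -/
  O4 : ∀ (x y : ℕ → S) (a b : S), Monotone x → Monotone y → IsLUB (Set.range x) a →
    IsLUB (Set.range y) b → IsLUB (Set.range fun n => x n + y n) (a + b)

/-- Generalized Cu-morphisms: order-preserving monoid morphisms that preserve suprema of
increasing sequences. -/
structure IsGenCuMorphism {S T : Type*} [AddCommMonoid S] [PartialOrder S] [IsCuSemigroup S]
    [AddCommMonoid T] [PartialOrder T] [IsCuSemigroup T] (φ : S → T) : Prop where
  map_zero : φ 0 = 0
  map_add : ∀ x y, φ (x + y) = φ x + φ y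
  monotone : Monotone φ
  map_sup : ∀ (x : ℕ → S) (s : S), Monotone x → IsLUB (Set.range x) s →
    IsLUB (Set.range fun n => φ (x n)) (φ s)

/-- Cu-morphisms: generalized Cu-morphisms that preserve `≪`. -/
structure IsCuMorphism {S T : Type*} [AddCommMonoid S] [PartialOrder S] [IsCuSemigroup S]
    [AddCommMonoid T] [PartialOrder T] [IsCuSemigroup T] (φ : S → T) : Prop
    extends IsGenCuMorphism φ where
  map_wayBelow : ∀ x y, WayBelow x y → WayBelow (φ x) (φ y)

/-- Almost unperforated maps. -/
def AlmostUnperforated {S T : Type*} [AddCommMonoid S] [PartialOrder S] [PartialOrder T]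
    (φ : S → T) : Prop :=
  ∀ (m : ℕ) (x y : S), (m + 1) • x ≤ m • y → φ x ≤ φ y

/-- Almost divisible maps. -/
def AlmostDivisible {S T : Type*} [PartialOrder S] [AddCommMonoid T] [PartialOrder T]
    (φ : S → T) : Prop :=
  ∀ (k : ℕ) (x' x : S), WayBelow x' x → ∃ z : T, k • z ≤ φ x ∧ φ x' ≤ (k + 1) • z

/-- Strongly soft elements: whenever `x' ≪ x`, there is `t` with `x' + t ≤ x ≤ ∞ t`, where
`∞ t` is the supremum of the sequence `n t`. -/
def StronglySoft {S : Type*} [AddCommMonoid S] [PartialOrder S] (x : S) : Prop :=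
  ∀ x' : S, WayBelow x' x → ∃ t s : S, x' + t ≤ x ∧
    IsLUB (Set.range fun n : ℕ => n • t) s ∧ x ≤ s

/-- Soft maps: the image consists of strongly soft elements. -/
def IsSoftMap {S T : Type*} [AddCommMonoid T] [PartialOrder T] (φ : S → T) : Prop :=
  ∀ x : S, StronglySoft (φ x)

/-! ### Basic facts on `≪` -/

section Basic

variable {S : Type*} [PartialOrder S]

theorem WayBelow.le {x y : S} (h : WayBelow x y) : x ≤ y := by
  obtain ⟨_, hn⟩ := h (fun _ => y) y monotone_const (by simp) le_rfl
  exact hn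

theorem WayBelow.trans_le {x y z : S} (h : WayBelow x y) (h' : y ≤ z) : WayBelow x z :=
  fun u s hu hs hz => h u s hu hs (h'.trans hz)

theorem WayBelow.le_trans {x y z : S} (h : x ≤ y) (h' : WayBelow y z) : WayBelow x z :=
  fun u s hu hs hz => (h' u s hu hs hz).imp fun _ hn => h.trans hn

variable [AddCommMonoid S] [IsCuSemigroup S]

theorem wayBelow_zero (x : S) : WayBelow 0 x :=
  fun _ _ _ _ _ => ⟨0, IsCuSemigroup.zero_le' _⟩

end Basic

/-! ### The Cu-semigroup `[0,∞]` -/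

theorem ennreal_wayBelow_of_lt {x y : ℝ≥0∞} (h : x < y) : WayBelow x y := by
  intro z s _ hs hy
  obtain ⟨_, ⟨n, rfl⟩, hn⟩ := (lt_isLUB_iff hs).1 (h.trans_le hy)
  exact ⟨n, hn.le⟩

theorem ennreal_wayBelow_iff {x y : ℝ≥0∞} : WayBelow x y ↔ x = 0 ∨ x < y := by
  constructor
  · intro h
    rcases eq_or_ne y 0 with rfl | hy
    · exact Or.inl (le_antisymm h.le bot_le)
    · obtain ⟨u, hu, hlt, hlim⟩ := exists_seq_strictMono_tendsto' (bot_lt_iff_ne_bot.2 hy)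
      obtain ⟨n, hn⟩ := h u y hu.monotone (isLUB_of_tendsto_atTop hu.monotone hlim) le_rfl
      exact Or.inr (hn.trans_lt (hlt n).2)
  · rintro (rfl | h)
    · exact fun _ _ _ _ _ => ⟨0, bot_le⟩
    · exact ennreal_wayBelow_of_lt h

instance : IsCuSemigroup ℝ≥0∞ where
  add_le_add' _ _ _ _ h h' := add_le_add h h'
  zero_le' _ := bot_le
  O1 x _ := ⟨_, isLUB_iSup⟩
  O2 x := by
    rcases eq_or_ne x 0 with rfl | hx
    · exact ⟨fun _ => 0, fun _ => ennreal_wayBelow_iff.2 (Or.inl rfl), by simp⟩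
    · obtain ⟨u, hu, _, hlim⟩ := exists_seq_strictMono_tendsto' (bot_lt_iff_ne_bot.2 hx)
      exact ⟨u, fun n => ennreal_wayBelow_of_lt (hu n.lt_succ_self),
        isLUB_of_tendsto_atTop hu.monotone hlim⟩
  O3 x' x y' y hx hy := by
    rw [ennreal_wayBelow_iff] at hx hy ⊢
    rcases hx with rfl | hx <;> rcases hy with rfl | hy
    · simp
    · exact Or.inr (by simpa using hy.trans_le le_add_self)
    · exact Or.inr (by simpa using hx.trans_le le_self_add)
    · exact Or.inr (ENNReal.add_lt_add hx hy)
  O4 x y a b hx hy ha hb := by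
    rw [← ha.iSup_eq, ← hb.iSup_eq, ENNReal.iSup_add_iSup_of_monotone hx hy]
    exact isLUB_iSup

/-! ### Tensor products of Cu-semigroups

The tensor product `S ⊗ T` is constructed as the Cu-completion of the algebraic tensor product of
positively ordered monoids. Formal sums `∑ sᵢ ⊗ tᵢ` are multisets of pairs. -/

section Tensor

variable {S T : Type*} [AddCommMonoid S] [PartialOrder S] [AddCommMonoid T] [PartialOrder T]

/-- The preorder on formal sums that defines the algebraic tensor product of positively ordered
monoids: the smallest additive preorder for which formal sums are positive and for which
`(s, t) ↦ s ⊗ t` is biadditive and order-preserving. -/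
inductive FormalLe : Multiset (S × T) → Multiset (S × T) → Prop
  | refl (f) : FormalLe f f
  | trans {f g h} : FormalLe f g → FormalLe g h → FormalLe f h
  | add {f f' g g'} : FormalLe f f' → FormalLe g g' → FormalLe (f + g) (f' + g')
  | mono {s s' : S} {t t' : T} : s ≤ s' → t ≤ t' → FormalLe {(s, t)} {(s', t')}
  | pos (s : S) (t : T) : FormalLe 0 {(s, t)}
  | zero_left (t : T) : FormalLe {(0, t)} 0
  | zero_right (s : S) : FormalLe {(s, 0)} 0
  | add_left (s₁ s₂ : S) (t : T) : FormalLe {(s₁ + s₂, t)} ({(s₁, t)} + {(s₂, t)})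
  | add_left' (s₁ s₂ : S) (t : T) : FormalLe ({(s₁, t)} + {(s₂, t)}) {(s₁ + s₂, t)}
  | add_right (s : S) (t₁ t₂ : T) : FormalLe {(s, t₁ + t₂)} ({(s, t₁)} + {(s, t₂)})
  | add_right' (s : S) (t₁ t₂ : T) : FormalLe ({(s, t₁)} + {(s, t₂)}) {(s, t₁ + t₂)}

/-- `∑ sᵢ ⊗ tᵢ` and `∑ sᵢ' ⊗ tᵢ'` with `sᵢ ≪ sᵢ'` and `tᵢ ≪ tᵢ'` for all `i`. -/
def TermwiseBelow (f g : Multiset (S × T)) : Prop :=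
  Multiset.Rel (fun p q => WayBelow p.1 q.1 ∧ WayBelow p.2 q.2) f g

/-- The auxiliary relation `≺` on formal sums induced by the relations `≪` of `S` and `T`. -/
def Prec (f g : Multiset (S × T)) : Prop :=
  ∃ f' g', FormalLe f f' ∧ TermwiseBelow f' g' ∧ FormalLe g' g

theorem TermwiseBelow.le {f g : Multiset (S × T)} (h : TermwiseBelow f g) : FormalLe f g := by
  induction h with
  | zero => exact .refl _
  | @cons a b as bs hab _ ih =>
    rw [← Multiset.singleton_add, ← Multiset.singleton_add]
    exact .add (.mono hab.1.le hab.2.le) ih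

theorem Prec.le {f g : Multiset (S × T)} (h : Prec f g) : FormalLe f g := by
  obtain ⟨f', g', h1, h2, h3⟩ := h
  exact h1.trans (h2.le.trans h3)

theorem Prec.trans_le {f g h : Multiset (S × T)} (h1 : Prec f g) (h2 : FormalLe g h) :
    Prec f h := by
  obtain ⟨f', g', a, b, c⟩ := h1
  exact ⟨f', g', a, b, c.trans h2⟩

theorem Prec.of_le {f g h : Multiset (S × T)} (h1 : FormalLe f g) (h2 : Prec g h) :
    Prec f h := by
  obtain ⟨f', g', a, b, c⟩ := h2
  exact ⟨f', g', h1.trans a, b, c⟩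

theorem Prec.trans {f g h : Multiset (S × T)} (h1 : Prec f g) (h2 : Prec g h) : Prec f h :=
  h1.trans_le h2.le

theorem Prec.add {f f' g g' : Multiset (S × T)} (h1 : Prec f f') (h2 : Prec g g') :
    Prec (f + g) (f' + g') := by
  obtain ⟨a, b, h3, h4, h5⟩ := h1
  obtain ⟨c, d, h6, h7, h8⟩ := h2
  exact ⟨a + c, b + d, h3.add h6, Multiset.Rel.add h4 h7, h5.add h8⟩

theorem Prec.zero_zero : Prec (0 : Multiset (S × T)) 0 :=
  ⟨0, 0, .refl _, Multiset.Rel.zero, .refl _⟩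

variable (S T) in
/-- `≺`-increasing sequences of formal sums. -/
structure PrecSeq where
  seq : ℕ → Multiset (S × T)
  prec : ∀ n, Prec (seq n) (seq (n + 1))

theorem PrecSeq.prec_lt (a : PrecSeq S T) {m n : ℕ} (h : m < n) : Prec (a.seq m) (a.seq n) := by
  induction n, h using Nat.le_induction with
  | base => exact a.prec m
  | succ n _ ih => exact ih.trans (a.prec n)

theorem PrecSeq.le_le (a : PrecSeq S T) {m n : ℕ} (h : m ≤ n) :
    FormalLe (a.seq m) (a.seq n) := by
  rcases h.eq_or_lt with rfl | h
  · exact .refl _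
  · exact (a.prec_lt h).le

instance : Preorder (PrecSeq S T) where
  le a b := ∀ n, ∃ m, Prec (a.seq n) (b.seq m)
  le_refl a n := ⟨n + 1, a.prec n⟩
  le_trans a b c h1 h2 n := by
    obtain ⟨m, hm⟩ := h1 n
    obtain ⟨k, hk⟩ := h2 m
    exact ⟨k, hm.trans hk⟩

theorem PrecSeq.le_def {a b : PrecSeq S T} : a ≤ b ↔ ∀ n, ∃ m, Prec (a.seq n) (b.seq m) :=
  Iff.rfl

instance : Add (PrecSeq S T) where
  add a b := ⟨fun n => a.seq n + b.seq n, fun n => (a.prec n).add (b.prec n)⟩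

instance : Zero (PrecSeq S T) where
  zero := ⟨fun _ => 0, fun _ => Prec.zero_zero⟩

theorem PrecSeq.add_seq (a b : PrecSeq S T) (n : ℕ) : (a + b).seq n = a.seq n + b.seq n := rfl

theorem PrecSeq.zero_seq (n : ℕ) : (0 : PrecSeq S T).seq n = 0 := rfl

theorem PrecSeq.ext {a b : PrecSeq S T} (h : ∀ n, a.seq n = b.seq n) : a = b := by
  cases a; cases b; congr; exact funext h

theorem PrecSeq.add_le_add {a b c d : PrecSeq S T} (h1 : a ≤ b) (h2 : c ≤ d) :
    a + c ≤ b + d := by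
  intro n
  obtain ⟨m, hm⟩ := h1 n
  obtain ⟨k, hk⟩ := h2 n
  exact ⟨max m k, (hm.trans_le (b.le_le (le_max_left _ _))).add
    (hk.trans_le (d.le_le (le_max_right _ _)))⟩

variable (S T) in
/-- The tensor product `S ⊗ T` of Cu-semigroups: `≺`-increasing sequences of formal sums, where
`a ≤ b` means that every `a n` satisfies `a n ≺ b m` for some `m`, and where sequences `a`, `b`
with `a ≤ b` and `b ≤ a` are identified. Addition is termwise. -/
def Tensor : Type _ := Antisymmetrization (PrecSeq S T) (· ≤ ·)

instance : PartialOrder (Tensor S T) :=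
  inferInstanceAs (PartialOrder (Antisymmetrization (PrecSeq S T) (· ≤ ·)))

/-- The class of a `≺`-increasing sequence. -/
def Tensor.mk (a : PrecSeq S T) : Tensor S T := toAntisymmetrization (· ≤ ·) a

theorem Tensor.mk_le_mk {a b : PrecSeq S T} : Tensor.mk a ≤ Tensor.mk b ↔ a ≤ b := Iff.rfl

theorem Tensor.ind {p : Tensor S T → Prop} (h : ∀ a, p (Tensor.mk a)) (x : Tensor S T) : p x :=
  Quotient.inductionOn' x h

theorem Tensor.exists_rep (x : Tensor S T) : ∃ a, Tensor.mk a = x :=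
  Tensor.ind (p := fun x => ∃ a, Tensor.mk a = x) (fun a => ⟨a, rfl⟩) x

instance : Zero (Tensor S T) := ⟨Tensor.mk 0⟩

instance : Add (Tensor S T) where
  add x y := Quotient.liftOn₂' x y (fun a b => Tensor.mk (a + b)) fun _ _ _ _ h h' =>
    le_antisymm (Tensor.mk_le_mk.2 (PrecSeq.add_le_add h.1 h'.1))
      (Tensor.mk_le_mk.2 (PrecSeq.add_le_add h.2 h'.2))

theorem Tensor.mk_add (a b : PrecSeq S T) :
    Tensor.mk (a + b) = Tensor.mk a + Tensor.mk b := rfl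

theorem Tensor.mk_zero : Tensor.mk (0 : PrecSeq S T) = 0 := rfl

instance : AddCommMonoid (Tensor S T) where
  add_assoc x y z := by
    obtain ⟨a, rfl⟩ := x.exists_rep
    obtain ⟨b, rfl⟩ := y.exists_rep
    obtain ⟨c, rfl⟩ := z.exists_rep
    simp only [← Tensor.mk_add]
    congr 1
    exact PrecSeq.ext fun n => by simp only [PrecSeq.add_seq, add_assoc]
  zero_add x := by
    obtain ⟨a, rfl⟩ := x.exists_rep
    rw [← Tensor.mk_zero, ← Tensor.mk_add]
    congr 1
    exact PrecSeq.ext fun n => by simp only [PrecSeq.add_seq, PrecSeq.zero_seq, zero_add]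
  add_zero x := by
    obtain ⟨a, rfl⟩ := x.exists_rep
    rw [← Tensor.mk_zero, ← Tensor.mk_add]
    congr 1
    exact PrecSeq.ext fun n => by simp only [PrecSeq.add_seq, PrecSeq.zero_seq, add_zero]
  add_comm x y := by
    obtain ⟨a, rfl⟩ := x.exists_rep
    obtain ⟨b, rfl⟩ := y.exists_rep
    simp only [← Tensor.mk_add]
    congr 1
    exact PrecSeq.ext fun n => by simp only [PrecSeq.add_seq, add_comm]
  nsmul := nsmulRec

end Tensor

/-! ### Pure tensors, and the axioms (O1)-(O4) for the tensor product -/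

section Pure

set_option linter.unusedSectionVars false

variable {S T : Type*} [AddCommMonoid S] [PartialOrder S] [IsCuSemigroup S]
  [AddCommMonoid T] [PartialOrder T] [IsCuSemigroup T]

/-- A chosen `≪`-increasing sequence with supremum `x`. -/
noncomputable def approx (x : S) : ℕ → S := (IsCuSemigroup.O2 x).choose

theorem approx_wayBelow (x : S) (n : ℕ) : WayBelow (approx x n) (approx x (n + 1)) :=
  (IsCuSemigroup.O2 x).choose_spec.1 n

theorem approx_isLUB (x : S) : IsLUB (Set.range (approx x)) x :=
  (IsCuSemigroup.O2 x).choose_spec.2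

theorem approx_mono (x : S) : Monotone (approx x) :=
  monotone_nat_of_le_succ fun n => (approx_wayBelow x n).le

theorem approx_wayBelow_self (x : S) (n : ℕ) : WayBelow (approx x n) x :=
  (approx_wayBelow x n).trans_le ((approx_isLUB x).1 ⟨n + 1, rfl⟩)

theorem exists_le_approx {x' x : S} (h : WayBelow x' x) : ∃ n, x' ≤ approx x n :=
  h _ x (approx_mono x) (approx_isLUB x) le_rfl

/-- The sequence `∑ᵢ s_{i,n} ⊗ t_{i,n}` for `f = ∑ᵢ sᵢ ⊗ tᵢ`, where `s_{i,n}` and `t_{i,n}` are the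
chosen `≪`-increasing sequences with suprema `sᵢ` and `tᵢ`. -/
noncomputable def formalApprox (f : Multiset (S × T)) (n : ℕ) : Multiset (S × T) :=
  f.map fun p => (approx p.1 n, approx p.2 n)

theorem formalApprox_termwise (f : Multiset (S × T)) (n : ℕ) :
    TermwiseBelow (formalApprox f n) (formalApprox f (n + 1)) := by
  refine Multiset.rel_map.2 (Multiset.rel_refl_of_refl_on fun p _ => ?_)
  exact ⟨approx_wayBelow _ _, approx_wayBelow _ _⟩

theorem formalApprox_termwise_self (f : Multiset (S × T)) (n : ℕ) :
    TermwiseBelow (formalApprox f n) f := by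
  refine Multiset.rel_map_left.2 (Multiset.rel_refl_of_refl_on fun p _ => ?_)
  exact ⟨approx_wayBelow_self _ _, approx_wayBelow_self _ _⟩

/-- The `≺`-increasing sequence `formalApprox f`. -/
noncomputable def below (f : Multiset (S × T)) : PrecSeq S T where
  seq := formalApprox f
  prec n := ⟨_, _, .refl _, formalApprox_termwise f n, .refl _⟩

/-- The pure tensor `x ⊗ y`: the class of `(xₙ ⊗ yₙ)ₙ` for `≪`-increasing sequences `(xₙ)` and
`(yₙ)` with suprema `x` and `y`. The class does not depend on the sequences, see
`Tensor.mk_eq_pure`. -/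
noncomputable def Tensor.pure (x : S) (y : T) : Tensor S T := Tensor.mk (below {(x, y)})

theorem termwise_le_formalApprox {f g : Multiset (S × T)} (h : TermwiseBelow f g) :
    ∃ n, FormalLe f (formalApprox g n) := by
  induction h with
  | zero => exact ⟨0, .refl _⟩
  | @cons a b as bs hab _ ih =>
    obtain ⟨n, hn⟩ := ih
    obtain ⟨k, hk⟩ := exists_le_approx hab.1
    obtain ⟨l, hl⟩ := exists_le_approx hab.2
    refine ⟨max n (max k l), ?_⟩
    rw [formalApprox, Multiset.map_cons, ← Multiset.singleton_add, ← Multiset.singleton_add]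
    refine .add (.mono (hk.trans (approx_mono _ (by simp))) (hl.trans (approx_mono _ (by simp))))
      (hn.trans ((below bs).le_le (le_max_left _ _)))

theorem exists_add_of_wayBelow_add {x a b : S} (h : WayBelow x (a + b)) :
    ∃ a' b', WayBelow a' a ∧ WayBelow b' b ∧ x ≤ a' + b' := by
  obtain ⟨n, hn⟩ := h (fun n => approx a n + approx b n) (a + b)
    (fun i j hij => IsCuSemigroup.add_le_add' _ _ _ _ (approx_mono a hij) (approx_mono b hij))
    (IsCuSemigroup.O4 _ _ _ _ (approx_mono a) (approx_mono b) (approx_isLUB a) (approx_isLUB b))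
    le_rfl
  exact ⟨_, _, approx_wayBelow_self a n, approx_wayBelow_self b n, hn⟩

theorem exists_common {x y a : S} (hx : WayBelow x a) (hy : WayBelow y a) :
    ∃ z, x ≤ z ∧ y ≤ z ∧ WayBelow z a := by
  obtain ⟨n, hn⟩ := exists_le_approx hx
  obtain ⟨m, hm⟩ := exists_le_approx hy
  exact ⟨approx a (max n m), hn.trans (approx_mono a (le_max_left _ _)),
    hm.trans (approx_mono a (le_max_right _ _)), approx_wayBelow_self _ _⟩

theorem termwise_singleton {f : Multiset (S × T)} {s : S} {t : T}
    (h : TermwiseBelow f {(s, t)}) :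
    ∃ s' t', f = {(s', t')} ∧ WayBelow s' s ∧ WayBelow t' t := by
  obtain ⟨⟨s', t'⟩, bs, h1, h2, rfl⟩ := Multiset.rel_cons_right.1 h
  rw [Multiset.rel_zero_right] at h2
  subst h2
  exact ⟨s', t', rfl, h1.1, h1.2⟩

theorem termwise_single {s s' : S} {t t' : T} (h : WayBelow s' s) (h' : WayBelow t' t) :
    TermwiseBelow ({(s', t')} : Multiset (S × T)) {(s, t)} :=
  Multiset.Rel.cons ⟨h, h'⟩ Multiset.Rel.zero

theorem termwise_interpolate {g h : Multiset (S × T)} (hgh : FormalLe g h) :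
    ∀ f, TermwiseBelow f g → ∃ h', FormalLe f h' ∧ TermwiseBelow h' h := by
  induction hgh with
  | refl g => exact fun f hf => ⟨f, .refl _, hf⟩
  | trans _ _ ih1 ih2 =>
    intro f hf
    obtain ⟨k, h1, h2⟩ := ih1 f hf
    obtain ⟨l, h3, h4⟩ := ih2 k h2
    exact ⟨l, h1.trans h3, h4⟩
  | add _ _ ih1 ih2 =>
    intro f hf
    obtain ⟨f1, f2, h1, h2, rfl⟩ := Multiset.rel_add_right.1 hf
    obtain ⟨k, h3, h4⟩ := ih1 f1 h1
    obtain ⟨l, h5, h6⟩ := ih2 f2 h2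
    exact ⟨k + l, h3.add h5, Multiset.Rel.add h4 h6⟩
  | mono hs ht =>
    intro f hf
    obtain ⟨s', t', rfl, h1, h2⟩ := termwise_singleton hf
    exact ⟨_, .refl _, termwise_single (h1.trans_le hs) (h2.trans_le ht)⟩
  | pos s t =>
    intro f hf
    obtain rfl := Multiset.rel_zero_right.1 hf
    exact ⟨{(0, 0)}, .pos _ _, termwise_single (wayBelow_zero _) (wayBelow_zero _)⟩
  | zero_left t =>
    intro f hf
    obtain ⟨s', t', rfl, h1, _⟩ := termwise_singleton hf
    exact ⟨0, .trans (.mono h1.le le_rfl) (.zero_left t'), Multiset.Rel.zero⟩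
  | zero_right s =>
    intro f hf
    obtain ⟨s', t', rfl, _, h2⟩ := termwise_singleton hf
    exact ⟨0, .trans (.mono le_rfl h2.le) (.zero_right s'), Multiset.Rel.zero⟩
  | add_left s₁ s₂ t =>
    intro f hf
    obtain ⟨s', t', rfl, h1, h2⟩ := termwise_singleton hf
    obtain ⟨a, b, ha, hb, hab⟩ := exists_add_of_wayBelow_add h1
    exact ⟨_, .trans (.mono hab le_rfl) (.add_left a b t'),
      Multiset.Rel.add (termwise_single ha h2) (termwise_single hb h2)⟩
  | add_left' s₁ s₂ t =>
    intro f hf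
    obtain ⟨f1, f2, h1, h2, rfl⟩ := Multiset.rel_add_right.1 hf
    obtain ⟨a, c, rfl, ha, hc⟩ := termwise_singleton h1
    obtain ⟨b, d, rfl, hb, hd⟩ := termwise_singleton h2
    obtain ⟨e, he1, he2, he⟩ := exists_common hc hd
    exact ⟨_, .trans (.add (.mono le_rfl he1) (.mono le_rfl he2)) (.add_left' a b e),
      termwise_single (IsCuSemigroup.O3 _ _ _ _ ha hb) he⟩
  | add_right s t₁ t₂ =>
    intro f hf
    obtain ⟨s', t', rfl, h1, h2⟩ := termwise_singleton hf
    obtain ⟨a, b, ha, hb, hab⟩ := exists_add_of_wayBelow_add h2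
    exact ⟨_, .trans (.mono le_rfl hab) (.add_right s' a b),
      Multiset.Rel.add (termwise_single h1 ha) (termwise_single h1 hb)⟩
  | add_right' s t₁ t₂ =>
    intro f hf
    obtain ⟨f1, f2, h1, h2, rfl⟩ := Multiset.rel_add_right.1 hf
    obtain ⟨c, a, rfl, hc, ha⟩ := termwise_singleton h1
    obtain ⟨d, b, rfl, hd, hb⟩ := termwise_singleton h2
    obtain ⟨e, he1, he2, he⟩ := exists_common hc hd
    exact ⟨_, .trans (.add (.mono he1 le_rfl) (.mono he2 le_rfl)) (.add_right' e a b),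
      termwise_single he (IsCuSemigroup.O3 _ _ _ _ ha hb)⟩

theorem Prec.exists_below {f g : Multiset (S × T)} (h : Prec f g) :
    ∃ n, Prec f ((below g).seq n) := by
  obtain ⟨f', g', h1, h2, h3⟩ := h
  obtain ⟨k, h4, h5⟩ := termwise_interpolate h3 f' h2
  obtain ⟨n, hn⟩ := termwise_le_formalApprox h5
  exact ⟨n + 1, Prec.of_le (h1.trans (h4.trans hn)) ((below g).prec n)⟩

theorem below_prec (g : Multiset (S × T)) (n : ℕ) : Prec ((below g).seq n) g :=
  ⟨_, _, .refl _, formalApprox_termwise_self g n, .refl _⟩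

theorem Tensor.mk_eq_pure {x : S} {y : T} {a : PrecSeq S T} {u : ℕ → S} {v : ℕ → T}
    (hu : ∀ n, WayBelow (u n) (u (n + 1))) (hv : ∀ n, WayBelow (v n) (v (n + 1)))
    (hux : IsLUB (Set.range u) x) (hvy : IsLUB (Set.range v) y)
    (ha : ∀ n, a.seq n = {(u n, v n)}) : Tensor.mk a = Tensor.pure x y := by
  have mu : Monotone u := monotone_nat_of_le_succ fun n => (hu n).le
  have mv : Monotone v := monotone_nat_of_le_succ fun n => (hv n).le
  apply le_antisymm
  · refine Tensor.mk_le_mk.2 fun n => Prec.exists_below ?_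
    rw [ha]
    exact ⟨_, _, .refl _, termwise_single (hu n) (hv n),
      .mono (hux.1 ⟨n + 1, rfl⟩) (hvy.1 ⟨n + 1, rfl⟩)⟩
  · refine Tensor.mk_le_mk.2 fun n => ?_
    obtain ⟨k, hk⟩ := approx_wayBelow_self x n u x mu hux le_rfl
    obtain ⟨l, hl⟩ := approx_wayBelow_self y n v y mv hvy le_rfl
    refine ⟨max k l + 1, Prec.of_le (g := a.seq (max k l)) ?_ (a.prec _)⟩
    rw [ha]
    exact .mono (hk.trans (mu (le_max_left _ _))) (hl.trans (mv (le_max_right _ _)))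

/-- A diagonal sequence that represents the supremum of an increasing sequence. -/
theorem Tensor.exists_diag (a : ℕ → PrecSeq S T) (ha : Monotone a) :
    ∃ (b : PrecSeq S T) (m : ℕ → ℕ), (∀ n, b.seq n = (a n).seq (m n)) ∧
      IsLUB (Set.range fun n => Tensor.mk (a n)) (Tensor.mk b) := by
  have step : ∀ n k : ℕ, ∃ l, Prec ((a n).seq k) ((a (n + 1)).seq l) ∧
      ∀ i ≤ n, Prec ((a i).seq n) ((a (n + 1)).seq l) := by
    intro n k
    have key : ∀ i j : ℕ, i ≤ n → ∃ l, Prec ((a i).seq j) ((a (n + 1)).seq l) :=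
      fun i j hi => ha (hi.trans n.le_succ) j
    have fin : ∀ N ≤ n + 1, ∃ l, ∀ i < N, Prec ((a i).seq n) ((a (n + 1)).seq l) := by
      intro N
      induction N with
      | zero => exact fun _ => ⟨0, fun i hi => absurd hi (Nat.not_lt_zero i)⟩
      | succ N ih =>
        intro hN
        obtain ⟨l, hl⟩ := ih (by omega)
        obtain ⟨l', hl'⟩ := key N n (by omega)
        refine ⟨max l l', fun i hi => ?_⟩
        rcases Nat.lt_succ_iff_lt_or_eq.1 hi with hi | rfl
        · exact (hl i hi).trans_le ((a (n + 1)).le_le (le_max_left _ _))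
        · exact hl'.trans_le ((a (n + 1)).le_le (le_max_right _ _))
    obtain ⟨l, hl⟩ := fin (n + 1) le_rfl
    obtain ⟨l', hl'⟩ := key n k le_rfl
    exact ⟨max l l', hl'.trans_le ((a (n + 1)).le_le (le_max_right _ _)), fun i hi =>
      (hl i (by omega)).trans_le ((a (n + 1)).le_le (le_max_left _ _))⟩
  choose F hF1 hF2 using step
  let m : ℕ → ℕ := fun n => Nat.rec 0 (fun n k => F n k) n
  refine ⟨⟨fun n => (a n).seq (m n), fun n => hF1 n (m n)⟩, m, fun _ => rfl, ?_, ?_⟩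
  · rintro _ ⟨i, rfl⟩
    refine Tensor.mk_le_mk.2 fun j => ⟨max i j + 1, ?_⟩
    exact Prec.of_le ((a i).le_le (le_max_right i j)) (hF2 (max i j) (m _) i (le_max_left _ _))
  · intro c hc
    obtain ⟨c, rfl⟩ := c.exists_rep
    exact Tensor.mk_le_mk.2 fun n => Tensor.mk_le_mk.1 (hc ⟨n, rfl⟩) (m n)

theorem Tensor.exists_reps (x : ℕ → Tensor S T) (hx : Monotone x) :
    ∃ a : ℕ → PrecSeq S T, Monotone a ∧ x = fun n => Tensor.mk (a n) := by
  choose a ha using fun n => (x n).exists_rep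
  obtain rfl : x = fun n => Tensor.mk (a n) := funext fun n => (ha n).symm
  exact ⟨a, fun i j h => hx h, rfl⟩

theorem Tensor.wayBelow_mk {a b : PrecSeq S T} {m : ℕ}
    (h : ∀ k, Prec (a.seq k) (b.seq m)) : WayBelow (Tensor.mk a) (Tensor.mk b) := by
  intro z s hz hs hb
  obtain ⟨z, hz', rfl⟩ := Tensor.exists_reps z hz
  obtain ⟨d, l, hd, hlub⟩ := Tensor.exists_diag z hz'
  rw [hs.unique hlub] at hb
  obtain ⟨j, hj⟩ := Tensor.mk_le_mk.1 hb m
  rw [hd] at hj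
  exact ⟨j, Tensor.mk_le_mk.2 fun k => ⟨l j, (h k).trans hj⟩⟩

theorem Tensor.isLUB_below (b : PrecSeq S T) :
    IsLUB (Set.range fun n => Tensor.mk (below (b.seq n))) (Tensor.mk b) := by
  constructor
  · rintro _ ⟨n, rfl⟩
    exact Tensor.mk_le_mk.2 fun k => ⟨n, below_prec _ k⟩
  · intro c hc
    obtain ⟨c, rfl⟩ := c.exists_rep
    refine Tensor.mk_le_mk.2 fun n => ?_
    obtain ⟨k, hk⟩ := (b.prec n).exists_below
    obtain ⟨j, hj⟩ := Tensor.mk_le_mk.1 (hc ⟨n + 1, rfl⟩) k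
    exact ⟨j, hk.trans hj⟩

theorem Tensor.monotone_below (b : PrecSeq S T) :
    Monotone fun n => Tensor.mk (below (b.seq n)) :=
  monotone_nat_of_le_succ fun n =>
    Tensor.mk_le_mk.2 fun k => ((below_prec _ k).trans (b.prec n)).exists_below

theorem Tensor.wayBelow_mk_iff {a b : PrecSeq S T} :
    WayBelow (Tensor.mk a) (Tensor.mk b) ↔ ∃ m, ∀ k, Prec (a.seq k) (b.seq m) := by
  refine ⟨fun h => ?_, fun ⟨_, h⟩ => Tensor.wayBelow_mk h⟩
  obtain ⟨n, hn⟩ := h _ _ (Tensor.monotone_below b) (Tensor.isLUB_below b) le_rfl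
  refine ⟨n, fun k => ?_⟩
  obtain ⟨j, hj⟩ := Tensor.mk_le_mk.1 hn k
  exact hj.trans (below_prec _ j)

instance : IsCuSemigroup (Tensor S T) where
  add_le_add' a b c d h h' := by
    obtain ⟨a, rfl⟩ := a.exists_rep
    obtain ⟨b, rfl⟩ := b.exists_rep
    obtain ⟨c, rfl⟩ := c.exists_rep
    obtain ⟨d, rfl⟩ := d.exists_rep
    exact Tensor.mk_le_mk.2 (PrecSeq.add_le_add h h')
  zero_le' a := by
    obtain ⟨a, rfl⟩ := a.exists_rep
    refine Tensor.mk_le_mk.2 fun n => ⟨1, ?_⟩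
    refine Prec.of_le (g := a.seq 0) ?_ (a.prec 0)
    rw [PrecSeq.zero_seq]
    induction a.seq 0 using Multiset.induction with
    | empty => exact .refl _
    | cons p f ih =>
      rw [← Multiset.singleton_add]
      simpa using FormalLe.add (.pos p.1 p.2) ih
  O1 x hx := by
    obtain ⟨a, ha, rfl⟩ := Tensor.exists_reps x hx
    obtain ⟨b, _, _, hb⟩ := Tensor.exists_diag a ha
    exact ⟨_, hb⟩
  O2 x := by
    obtain ⟨b, rfl⟩ := x.exists_rep
    refine ⟨fun n => Tensor.mk (below (b.seq n)), fun n => ?_, Tensor.isLUB_below b⟩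
    obtain ⟨m, hm⟩ := (b.prec n).exists_below
    exact Tensor.wayBelow_mk fun k => (below_prec _ k).trans hm
  O3 x' x y' y hx hy := by
    obtain ⟨a', rfl⟩ := x'.exists_rep
    obtain ⟨a, rfl⟩ := x.exists_rep
    obtain ⟨b', rfl⟩ := y'.exists_rep
    obtain ⟨b, rfl⟩ := y.exists_rep
    obtain ⟨m, hm⟩ := Tensor.wayBelow_mk_iff.1 hx
    obtain ⟨n, hn⟩ := Tensor.wayBelow_mk_iff.1 hy
    rw [← Tensor.mk_add, ← Tensor.mk_add]
    exact Tensor.wayBelow_mk (m := max m n) fun k =>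
      ((hm k).trans_le (a.le_le (le_max_left _ _))).add
        ((hn k).trans_le (b.le_le (le_max_right _ _)))
  O4 x y s t hx hy hs ht := by
    obtain ⟨a, ha, rfl⟩ := Tensor.exists_reps x hx
    obtain ⟨b, hb, rfl⟩ := Tensor.exists_reps y hy
    obtain ⟨c, k, hc, hc'⟩ := Tensor.exists_diag a ha
    obtain ⟨d, l, hd, hd'⟩ := Tensor.exists_diag b hb
    rw [hs.unique hc', ht.unique hd']
    constructor
    · rintro _ ⟨n, rfl⟩
      exact Tensor.mk_le_mk.2 (PrecSeq.add_le_add (hc'.1 ⟨n, rfl⟩) (hd'.1 ⟨n, rfl⟩))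
    · intro e he
      obtain ⟨e, rfl⟩ := e.exists_rep
      refine Tensor.mk_le_mk.2 fun n => ?_
      obtain ⟨j, hj⟩ := Tensor.mk_le_mk.1 (he ⟨n, rfl⟩) (max (k n) (l n))
      refine ⟨j, Prec.of_le ?_ hj⟩
      rw [PrecSeq.add_seq, PrecSeq.add_seq, hc, hd]
      exact .add ((a n).le_le (le_max_left _ _)) ((b n).le_le (le_max_right _ _))

end Pure

end Cu

open scoped ENNReal

namespace Cu

/-! ### Multiples in Cu-semigroups -/

section Multiples

variable {S : Type*} [AddCommMonoid S] [PartialOrder S] [IsCuSemigroup S]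

/-! The tensor product is universal for generalized Cu-bimorphisms
(`IsGenCuBimorphism.exists_lift`), so it suffices to find such a map `Φ` on `S₁ × [0,∞]` with `Φ(x,
1) = φ₂(φ₁(x))`. It should be `φ₂` applied to the real multiple `c φ₁(x)`, which `S₂` need not
contain.

Almost divisibility of `φ₁` supplies substitutes: for `x' ≪ x` and `c' ≪ c` there is `z` between `c'
φ₁(x')` and `c φ₁(x)`, where both bounds are inequalities between integer multiples (`SubMul`,
`SupMul`). Almost unperforation of `φ₂` makes them comparable: if `z` is at most `c y`, `z'` is at
least `d y` and `c ≪ d`, then `φ₂(z) ≤ φ₂(z')`. Interleaved substitutes thus have increasing images,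
and `Φ(x, c)` is the supremum of these. It is also the supremum of `φ₂(w)` over all "test elements"
`w` that are at most `c' φ₁(x')` for some `x' ≪ x`, `c' ≪ c`. Hence it depends on `x` and `c` only,
and every property of `Φ` reduces to comparing test elements with substitutes.

Softness enters only in `Φ(x, 1) ≥ φ₂(φ₁(x))`: an element `y ≪ φ₁(x)` satisfies `(n+1) y ≤ n φ₁(x)`
for some `n`, so it lies below a multiple of `φ₁(x)` with factor strictly less than `1`. -/

instance IsCuSemigroup.toIsOrderedAddMonoid : IsOrderedAddMonoid S where
  add_le_add_left _ _ h c := IsCuSemigroup.add_le_add' _ _ c c h le_rfl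

theorem le_zero_iff_eq {x : S} : x ≤ 0 ↔ x = 0 :=
  ⟨fun h => le_antisymm h (IsCuSemigroup.zero_le' x), fun h => h.le⟩

theorem WayBelow.nsmul {x' x : S} (h : WayBelow x' x) (n : ℕ) : WayBelow (n • x') (n • x) := by
  induction n with
  | zero => simpa using wayBelow_zero (0 : S)
  | succ n ih => simpa only [succ_nsmul] using IsCuSemigroup.O3 _ _ _ _ ih h

theorem isLUB_nsmul {x : ℕ → S} {s : S} (hx : Monotone x) (hs : IsLUB (Set.range x) s) (n : ℕ) :
    IsLUB (Set.range fun k => n • x k) (n • s) := by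
  induction n with
  | zero => simp
  | succ n ih =>
    simpa only [succ_nsmul] using
      IsCuSemigroup.O4 _ _ _ _ (fun i j hij => nsmul_le_nsmul_right (hx hij) n) hx ih hs

theorem eq_zero_of_nsmul_le_zero {x : S} {n : ℕ} (hn : 0 < n) (h : n • x ≤ 0) : x = 0 := by
  refine le_zero_iff_eq.1 (le_trans ?_ h)
  simpa using nsmul_le_nsmul_left (IsCuSemigroup.zero_le' x) hn

theorem WayBelow.exists_between {x' x : S} (h : WayBelow x' x) :
    ∃ y, WayBelow x' y ∧ WayBelow y x := by
  obtain ⟨n, hn⟩ := exists_le_approx h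
  exact ⟨approx x (n + 1), .le_trans hn (approx_wayBelow x n), approx_wayBelow_self x _⟩

/-- Since `x' ≪ x ≤ ∞ t`, some `n t` dominates `x'`; the remainders `t` of `n` copies of `x` then
absorb one further copy of `x'`. -/
theorem StronglySoft.exists_nsmul_le {x x' : S} (hx : StronglySoft x) (h : WayBelow x' x) :
    ∃ n : ℕ, (n + 1) • x' ≤ n • x := by
  obtain ⟨t, s, ht, hs, hxs⟩ := hx x' h
  obtain ⟨n, hn⟩ := h _ s
    (fun i j hij => nsmul_le_nsmul_left (IsCuSemigroup.zero_le' t) hij) hs hxs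
  refine ⟨n, ?_⟩
  calc (n + 1) • x' = n • x' + x' := succ_nsmul _ _
    _ ≤ n • x' + n • t := by gcongr
    _ = n • (x' + t) := (nsmul_add _ _ _).symm
    _ ≤ n • x := nsmul_le_nsmul_right ht n

theorem AlmostUnperforated.map_le {T : Type*} [PartialOrder T] {φ : S → T}
    (hφ : AlmostUnperforated φ) {x y : S} {a b : ℕ} (hab : b < a) (h : a • x ≤ b • y) :
    φ x ≤ φ y :=
  hφ b x y ((nsmul_le_nsmul_left (IsCuSemigroup.zero_le' x) hab).trans h)

end Multiples

section GenCuMorphism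

variable {S T : Type*} [AddCommMonoid S] [PartialOrder S] [IsCuSemigroup S]
  [AddCommMonoid T] [PartialOrder T] [IsCuSemigroup T]

theorem IsGenCuMorphism.map_nsmul {φ : S → T} (hφ : IsGenCuMorphism φ) (n : ℕ) (x : S) :
    φ (n • x) = n • φ x := by
  induction n with
  | zero => simp [hφ.map_zero]
  | succ n ih => rw [succ_nsmul, hφ.map_add, ih, succ_nsmul]

end GenCuMorphism

/-! ### The universal property of the tensor product -/

section FormalEval

variable {S T P : Type*} [AddCommMonoid P]

/-- The value of a map of two variables on formal sums. -/
def formalEval (Φ : S → T → P) (f : Multiset (S × T)) : P := (f.map fun p => Φ p.1 p.2).sum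

theorem formalEval_add (Φ : S → T → P) (f g : Multiset (S × T)) :
    formalEval Φ (f + g) = formalEval Φ f + formalEval Φ g := by
  simp [formalEval]

theorem formalEval_singleton (Φ : S → T → P) (s : S) (t : T) :
    formalEval Φ {(s, t)} = Φ s t := by
  simp [formalEval]

theorem formalEval_zero (Φ : S → T → P) : formalEval Φ 0 = 0 := by
  simp [formalEval]

end FormalEval

section Lift

set_option linter.unusedSectionVars false

variable {S T P : Type*} [AddCommMonoid S] [PartialOrder S] [IsCuSemigroup S]
  [AddCommMonoid T] [PartialOrder T] [IsCuSemigroup T]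
  [AddCommMonoid P] [PartialOrder P] [IsCuSemigroup P]

/-- Generalized Cu-bimorphisms: maps that are additive and monotone in each variable, and that
preserve joint suprema of increasing sequences. -/
structure IsGenCuBimorphism (Φ : S → T → P) : Prop where
  zero_left : ∀ t, Φ 0 t = 0
  zero_right : ∀ s, Φ s 0 = 0
  add_left : ∀ s₁ s₂ t, Φ (s₁ + s₂) t = Φ s₁ t + Φ s₂ t
  add_right : ∀ s t₁ t₂, Φ s (t₁ + t₂) = Φ s t₁ + Φ s t₂
  mono : ∀ s s' t t', s ≤ s' → t ≤ t' → Φ s t ≤ Φ s' t'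
  map_sup : ∀ (u : ℕ → S) (v : ℕ → T) (s : S) (t : T), Monotone u → Monotone v →
    IsLUB (Set.range u) s → IsLUB (Set.range v) t →
    IsLUB (Set.range fun n => Φ (u n) (v n)) (Φ s t)

variable {Φ : S → T → P}

theorem IsGenCuBimorphism.formalEval_le (hΦ : IsGenCuBimorphism Φ) {f g : Multiset (S × T)}
    (h : FormalLe f g) : formalEval Φ f ≤ formalEval Φ g := by
  induction h with
  | refl => exact le_rfl
  | trans _ _ ih₁ ih₂ => exact ih₁.trans ih₂
  | add _ _ ih₁ ih₂ => simpa only [formalEval_add] using add_le_add ih₁ ih₂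
  | mono hs ht => simpa only [formalEval_singleton] using hΦ.mono _ _ _ _ hs ht
  | pos s t => simpa only [formalEval_zero] using IsCuSemigroup.zero_le' _
  | zero_left t => simp [formalEval_singleton, formalEval_zero, hΦ.zero_left]
  | zero_right s => simp [formalEval_singleton, formalEval_zero, hΦ.zero_right]
  | add_left s₁ s₂ t => simp only [formalEval_singleton, formalEval_add, hΦ.add_left, le_refl]
  | add_left' s₁ s₂ t => simp only [formalEval_singleton, formalEval_add, hΦ.add_left, le_refl]
  | add_right s t₁ t₂ => simp only [formalEval_singleton, formalEval_add, hΦ.add_right, le_refl]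
  | add_right' s t₁ t₂ => simp only [formalEval_singleton, formalEval_add, hΦ.add_right, le_refl]

theorem IsGenCuBimorphism.formalEval_monotone (hΦ : IsGenCuBimorphism Φ) (a : PrecSeq S T) :
    Monotone fun n => formalEval Φ (a.seq n) :=
  fun _ _ h => hΦ.formalEval_le (a.le_le h)

/-- Only the termwise step in the definition of `≺` has to produce `≪`, and (O3) sums its terms; the
outer two steps need only monotonicity. -/
theorem IsGenCuBimorphism.formalEval_wayBelow (hΦ : IsGenCuBimorphism Φ)
    (hΦ' : ∀ s s' t t', WayBelow s s' → WayBelow t t' → WayBelow (Φ s t) (Φ s' t'))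
    {f g : Multiset (S × T)} (h : Prec f g) :
    WayBelow (formalEval Φ f) (formalEval Φ g) := by
  obtain ⟨f', g', h₁, h₂, h₃⟩ := h
  refine .le_trans (hΦ.formalEval_le h₁) (.trans_le ?_ (hΦ.formalEval_le h₃))
  clear h₁ h₃
  induction h₂ with
  | zero => exact wayBelow_zero _
  | cons hab _ ih =>
    simp only [formalEval, Multiset.map_cons, Multiset.sum_cons] at ih ⊢
    exact IsCuSemigroup.O3 _ _ _ _ (hΦ' _ _ _ _ hab.1 hab.2) ih

/-- Generalized Cu-bimorphisms factor through the tensor product, and the induced map is a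
Cu-morphism if the bimorphism preserves `≪` jointly. -/
theorem IsGenCuBimorphism.exists_lift (hΦ : IsGenCuBimorphism Φ) :
    ∃ γ : Tensor S T → P, IsGenCuMorphism γ ∧ (∀ s t, γ (Tensor.pure s t) = Φ s t) ∧
      ((∀ s s' t t', WayBelow s s' → WayBelow t t' → WayBelow (Φ s t) (Φ s' t')) →
        ∀ x y, WayBelow x y → WayBelow (γ x) (γ y)) := by
  -- The value on the class of a `≺`-increasing sequence is the supremum of the values of its terms.
  choose val hval using fun a : PrecSeq S T =>
    IsCuSemigroup.O1 _ (hΦ.formalEval_monotone a)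
  have val_mono : ∀ a b : PrecSeq S T, a ≤ b → val a ≤ val b := by
    intro a b hab
    refine (hval a).2 ?_
    rintro _ ⟨n, rfl⟩
    obtain ⟨m, hm⟩ := hab n
    exact (hΦ.formalEval_le hm.le).trans ((hval b).1 ⟨m, rfl⟩)
  obtain ⟨γ, hγ⟩ : ∃ γ : Tensor S T → P, ∀ a, γ (Tensor.mk a) = val a :=
    ⟨fun x => Quotient.liftOn' x val fun a b h =>
      le_antisymm (val_mono a b h.1) (val_mono b a h.2), fun _ => rfl⟩
  have γ_mono : Monotone γ := by
    intro x y hxy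
    obtain ⟨a, rfl⟩ := x.exists_rep
    obtain ⟨b, rfl⟩ := y.exists_rep
    rw [hγ, hγ]
    exact val_mono a b hxy
  refine ⟨γ, ⟨?_, ?_, γ_mono, ?_⟩, ?_, ?_⟩
  · rw [← Tensor.mk_zero, hγ]
    refine le_zero_iff_eq.1 ((hval 0).2 ?_)
    rintro _ ⟨n, rfl⟩
    exact (formalEval_zero Φ).le
  · intro x y
    obtain ⟨a, rfl⟩ := x.exists_rep
    obtain ⟨b, rfl⟩ := y.exists_rep
    rw [← Tensor.mk_add, hγ, hγ, hγ]
    refine (hval (a + b)).unique ?_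
    simp only [PrecSeq.add_seq, formalEval_add]
    exact IsCuSemigroup.O4 _ _ _ _ (hΦ.formalEval_monotone a) (hΦ.formalEval_monotone b)
      (hval a) (hval b)
  · intro x s hx hs
    obtain ⟨a, ha, rfl⟩ := Tensor.exists_reps x hx
    obtain ⟨b, m, hb, hlub⟩ := Tensor.exists_diag a ha
    rw [hs.unique hlub, hγ]
    constructor
    · rintro _ ⟨n, rfl⟩
      rw [← hγ]
      exact γ_mono (hlub.1 ⟨n, rfl⟩)
    · intro c hc
      refine (hval b).2 ?_
      rintro _ ⟨n, rfl⟩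
      refine le_trans ?_ (hc ⟨n, rfl⟩)
      -- The `n`-th term of the diagonal sequence is a term of `a n`, so its value is at most `val
      -- (a n)`.
      simp only [hγ, hb]
      exact (hval (a n)).1 ⟨m n, rfl⟩
  · intro s t
    rw [Tensor.pure, hγ]
    refine (hval _).unique ?_
    simpa [below, formalApprox, formalEval] using
      hΦ.map_sup _ _ s t (approx_mono s) (approx_mono t) (approx_isLUB s) (approx_isLUB t)
  · intro hΦ' x y hxy
    obtain ⟨a, rfl⟩ := x.exists_rep
    obtain ⟨b, rfl⟩ := y.exists_rep
    obtain ⟨m, hm⟩ := Tensor.wayBelow_mk_iff.1 hxy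
    rw [hγ, hγ]
    -- A single term of `b` dominates all of `a`, and the values of consecutive terms of `b` are
    -- related by `≪`.
    have hle : val a ≤ formalEval Φ (b.seq m) := by
      refine (hval a).2 ?_
      rintro _ ⟨n, rfl⟩
      exact hΦ.formalEval_le (hm n).le
    exact .le_trans hle ((hΦ.formalEval_wayBelow hΦ' (b.prec m)).trans_le
      ((hval b).1 ⟨m + 1, rfl⟩))

end Lift

/-! ### Comparison with real multiples -/

section RealMultiples

variable {S : Type*} [AddCommMonoid S] [PartialOrder S]

/-- `z` is at most a rational multiple `(M / N) y` with `M / N ≤ c`. -/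
def SubMul (z y : S) (c : ℝ≥0∞) : Prop :=
  ∃ M N : ℕ, 0 < N ∧ (M : ℝ≥0∞) ≤ c * N ∧ N • z ≤ M • y

/-- `z` is at least a rational multiple `(M / N) y` with `c ≤ M / N`. -/
def SupMul (z y : S) (c : ℝ≥0∞) : Prop :=
  ∃ M N : ℕ, 0 < N ∧ c * N ≤ (M : ℝ≥0∞) ∧ M • y ≤ N • z

variable [IsCuSemigroup S] {z z' y y' : S} {c d : ℝ≥0∞}

theorem SubMul.mono (h : SubMul z y c) (hy : y ≤ y') (hc : c ≤ d) : SubMul z y' d := by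
  obtain ⟨M, N, hN, hM, hz⟩ := h
  exact ⟨M, N, hN, hM.trans (by gcongr), hz.trans (nsmul_le_nsmul_right hy M)⟩

theorem SupMul.mono (h : SupMul z y c) (hy : y' ≤ y) (hc : d ≤ c) : SupMul z y' d := by
  obtain ⟨M, N, hN, hM, hz⟩ := h
  exact ⟨M, N, hN, le_trans (by gcongr) hM, (nsmul_le_nsmul_right hy M).trans hz⟩

theorem SubMul.eq_zero (h : SubMul z y 0) : z = 0 := by
  obtain ⟨M, N, hN, hM, hz⟩ := h
  obtain rfl : M = 0 := by simpa using hM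
  exact eq_zero_of_nsmul_le_zero hN (by simpa using hz)

theorem SubMul.eq_zero_of_zero (h : SubMul z 0 c) : z = 0 := by
  obtain ⟨M, N, hN, hM, hz⟩ := h
  exact eq_zero_of_nsmul_le_zero hN (by simpa using hz)

/-- Addition of fractions over the common denominator `N * L`. Distinct `u` and `v` serve additivity
in the element, `u = v` additivity in the factor. -/
theorem nsmul_add_le_of_le {a b M N K L : ℕ} {u v : S} (h : N • z ≤ M • u) (h' : L • z' ≤ K • v)
    (ha : L * M = a) (hb : N * K = b) : (N * L) • (z + z') ≤ a • u + b • v := by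
  subst ha hb
  calc (N * L) • (z + z') = L • (N • z) + N • (L • z') := by
        rw [nsmul_add, ← mul_nsmul, ← mul_nsmul, mul_comm L N]
    _ ≤ L • (M • u) + N • (K • v) :=
        add_le_add (nsmul_le_nsmul_right h L) (nsmul_le_nsmul_right h' N)
    _ = _ := by rw [← mul_nsmul', ← mul_nsmul']

theorem le_nsmul_add_of_le {a b M N K L : ℕ} {u v : S} (h : M • u ≤ N • z) (h' : K • v ≤ L • z')
    (ha : L * M = a) (hb : N * K = b) : a • u + b • v ≤ (N * L) • (z + z') := by
  subst ha hb
  calc (L * M) • u + (N * K) • v = L • (M • u) + N • (K • v) := by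
        rw [← mul_nsmul', ← mul_nsmul']
    _ ≤ L • (N • z) + N • (L • z') :=
        add_le_add (nsmul_le_nsmul_right h L) (nsmul_le_nsmul_right h' N)
    _ = _ := by rw [nsmul_add, ← mul_nsmul, ← mul_nsmul, mul_comm L N]

theorem SubMul.add_left (h : SubMul z y c) (h' : SubMul z' y' c) :
    SubMul (z + z') (y + y') c := by
  obtain ⟨M, N, hN, hM, hz⟩ := h
  obtain ⟨K, L, hL, hK, hz'⟩ := h'
  -- Both fractions are at most `c`, so the larger one is a common factor for `y` and `y'`.
  refine ⟨max (L * M) (N * K), N * L, by positivity, ?_, ?_⟩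
  · rw [Nat.mono_cast.map_max, max_le_iff]
    push_cast
    constructor
    · calc (L : ℝ≥0∞) * M ≤ L * (c * N) := by gcongr
        _ = _ := by ring
    · calc (N : ℝ≥0∞) * K ≤ N * (c * L) := by gcongr
        _ = _ := by ring
  · refine (nsmul_add_le_of_le hz hz' rfl rfl).trans ?_
    rw [nsmul_add]
    exact add_le_add (nsmul_le_nsmul_left (IsCuSemigroup.zero_le' _) (le_max_left _ _))
      (nsmul_le_nsmul_left (IsCuSemigroup.zero_le' _) (le_max_right _ _))

theorem SubMul.add_right (h : SubMul z y c) (h' : SubMul z' y d) :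
    SubMul (z + z') y (c + d) := by
  obtain ⟨M, N, hN, hM, hz⟩ := h
  obtain ⟨K, L, hL, hK, hz'⟩ := h'
  refine ⟨L * M + N * K, N * L, by positivity, ?_, ?_⟩
  · push_cast
    calc (L : ℝ≥0∞) * M + N * K ≤ L * (c * N) + N * (d * L) := by gcongr
      _ = _ := by ring
  · rw [add_nsmul]
    exact nsmul_add_le_of_le hz hz' rfl rfl

theorem SupMul.add_left (h : SupMul z y c) (h' : SupMul z' y' c) :
    SupMul (z + z') (y + y') c := by
  obtain ⟨M, N, hN, hM, hz⟩ := h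
  obtain ⟨K, L, hL, hK, hz'⟩ := h'
  refine ⟨min (L * M) (N * K), N * L, by positivity, ?_, ?_⟩
  · rw [Nat.mono_cast.map_min, le_min_iff]
    push_cast
    constructor
    · calc c * (N * L) = L * (c * N) := by ring
        _ ≤ (L : ℝ≥0∞) * M := by gcongr
    · calc c * (N * L) = N * (c * L) := by ring
        _ ≤ (N : ℝ≥0∞) * K := by gcongr
  · refine le_trans ?_ (le_nsmul_add_of_le hz hz' rfl rfl)
    rw [nsmul_add]
    exact add_le_add (nsmul_le_nsmul_left (IsCuSemigroup.zero_le' _) (min_le_left _ _))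
      (nsmul_le_nsmul_left (IsCuSemigroup.zero_le' _) (min_le_right _ _))

theorem SupMul.add_right (h : SupMul z y c) (h' : SupMul z' y d) :
    SupMul (z + z') y (c + d) := by
  obtain ⟨M, N, hN, hM, hz⟩ := h
  obtain ⟨K, L, hL, hK, hz'⟩ := h'
  refine ⟨L * M + N * K, N * L, by positivity, ?_, ?_⟩
  · push_cast
    calc (c + d) * ((N : ℝ≥0∞) * L) = L * (c * N) + N * (d * L) := by ring
      _ ≤ (L : ℝ≥0∞) * M + N * K := by gcongr
  · rw [add_nsmul]
    exact le_nsmul_add_of_le hz hz' rfl rfl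

/-- Here `M y' ≪ M y ≤ N z`, and `N z` is the supremum of the `N`-fold multiples of a `≪`-increasing
sequence with supremum `z`. -/
theorem SupMul.exists_wayBelow (h : SupMul z y c) (hy : WayBelow y' y) :
    ∃ w, WayBelow w z ∧ SupMul w y' c := by
  obtain ⟨M, N, hN, hM, hz⟩ := h
  obtain ⟨k, hk⟩ := hy.nsmul M _ _
    (fun i j hij => nsmul_le_nsmul_right (approx_mono z hij) N)
    (isLUB_nsmul (approx_mono z) (approx_isLUB z) N) hz
  exact ⟨approx z k, approx_wayBelow_self z k, M, N, hN, hM, hk⟩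

/-- Eliminating `y` by cross-multiplication gives `N K z ≤ M L z'`, and `M / N ≤ c < d ≤ K / L`
gives `M L < N K`. -/
theorem AlmostUnperforated.map_le_of_subMul {T : Type*} [PartialOrder T] {φ : S → T}
    (hφ : AlmostUnperforated φ) (hmono : Monotone φ) (h : SubMul z y c) (hcd : WayBelow c d)
    (h' : SupMul z' y d) : φ z ≤ φ z' := by
  -- `c ≪ d` yields a strict inequality unless `c = 0`, and then `z = 0`.
  rcases ennreal_wayBelow_iff.1 hcd with rfl | hcd
  · rw [h.eq_zero]
    exact hmono (IsCuSemigroup.zero_le' _)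
  obtain ⟨M, N, hN, hM, hz⟩ := h
  obtain ⟨K, L, hL, hK, hz'⟩ := h'
  refine hφ.map_le (a := N * K) (b := M * L) ?_ ?_
  · have : ((M * L : ℕ) : ℝ≥0∞) < (N * K : ℕ) := by
      push_cast
      calc (M : ℝ≥0∞) * L ≤ c * N * L := by gcongr
        _ = c * (N * L) := by ring
        _ < d * (N * L) := by
          refine ENNReal.mul_lt_mul_left ?_ ?_ hcd
          · simp [hN.ne', hL.ne']
          · exact ENNReal.mul_ne_top (ENNReal.natCast_ne_top _) (ENNReal.natCast_ne_top _)
        _ = N * (d * L) := by ring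
        _ ≤ N * K := by gcongr
    exact_mod_cast this
  · calc (N * K) • z = K • (N • z) := mul_nsmul _ _ _
      _ ≤ K • (M • y) := nsmul_le_nsmul_right hz K
      _ = M • (K • y) := smul_comm _ _ _
      _ ≤ M • (L • z') := nsmul_le_nsmul_right hz' M
      _ = _ := (mul_nsmul' _ _ _).symm

/-- Almost divisibility bounds with `N` on one side and `N + 1` on the other, so both `M / (N + 1)`
and `M / N` must lie in `[c, d]`. -/
theorem exists_nat_between_multiples (h : c < d) :
    ∃ M N : ℕ, 0 < N ∧ c * (N + 1 : ℕ) ≤ (M : ℝ≥0∞) ∧ (M : ℝ≥0∞) ≤ d * N := by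
  lift c to NNReal using h.ne_top
  -- `d` may be infinite; a finite `e` replaces it.
  obtain ⟨e, hce, hed⟩ := ENNReal.lt_iff_exists_nnreal_btwn.1 h
  have hce : (c : ℝ) < e := by exact_mod_cast hce
  have hpos : (0 : ℝ) < e - c := sub_pos.2 hce
  -- This makes the interval from `c (N + 1)` to `e N` longer than `1`, so it contains the ceiling
  -- of its left end.
  obtain ⟨N, hN⟩ := exists_nat_gt (((c : ℝ) + 1) / (e - c))
  have hN' : (c : ℝ) + 1 < N * (e - c) := (div_lt_iff₀ hpos).1 hN
  have hN0 : 0 < N := by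
    have : (0 : ℝ) < N := lt_of_le_of_lt (by positivity) hN
    exact_mod_cast this
  refine ⟨⌈(c : ℝ) * (N + 1)⌉₊, N, hN0, ?_, le_trans ?_ (mul_le_mul_left hed.le _)⟩
  · have : (c : ℝ) * (N + 1) ≤ ⌈(c : ℝ) * (N + 1)⌉₊ := Nat.le_ceil _
    have : c * ((N + 1 : ℕ) : NNReal) ≤ (⌈(c : ℝ) * (N + 1)⌉₊ : NNReal) := by
      rw [← NNReal.coe_le_coe]
      push_cast
      exact this
    exact_mod_cast this
  · have : (⌈(c : ℝ) * (N + 1)⌉₊ : ℝ) < c * (N + 1) + 1 := Nat.ceil_lt_add_one (by positivity)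
    have : (⌈(c : ℝ) * (N + 1)⌉₊ : NNReal) ≤ e * (N : NNReal) := by
      rw [← NNReal.coe_le_coe]
      push_cast
      nlinarith
    exact_mod_cast this

end RealMultiples

/-! ### The bimorphism of real multiples -/

section RealBimorphism

set_option linter.unusedSectionVars false

variable {S₁ S₂ T : Type*}
  [AddCommMonoid S₁] [PartialOrder S₁] [IsCuSemigroup S₁]
  [AddCommMonoid S₂] [PartialOrder S₂] [IsCuSemigroup S₂]
  [AddCommMonoid T] [PartialOrder T] [IsCuSemigroup T]
  {φ₁ : S₁ → S₂} {φ₂ : S₂ → T}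

theorem AlmostDivisible.exists_subMul_supMul (hdiv : AlmostDivisible φ₁)
    (h₁ : IsGenCuMorphism φ₁) {x' x : S₁} {c d : ℝ≥0∞} (hx : WayBelow x' x)
    (hcd : WayBelow c d) : ∃ z, SubMul z (φ₁ x) d ∧ SupMul z (φ₁ x') c := by
  rcases ennreal_wayBelow_iff.1 hcd with rfl | hcd
  · exact ⟨0, ⟨0, 1, by simp⟩, ⟨0, 1, by simp⟩⟩
  obtain ⟨M, N, hN, hM, hM'⟩ := exists_nat_between_multiples hcd
  -- Dividing `M φ₁(x)` by `N` approximates the multiple with factor `M / N`.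
  obtain ⟨z, hz, hz'⟩ := hdiv N (M • x') (M • x) (hx.nsmul M)
  rw [h₁.map_nsmul] at hz hz'
  exact ⟨z, ⟨M, N, hN, hM', hz⟩, ⟨M, N + 1, N.succ_pos, hM, hz'⟩⟩

/-- The sequence `(φ₂ (z n))ₙ` has supremum `s`, where the elements `z n` exhaust the real multiple
`c φ₁(x)`. -/
structure Exhausts (φ₁ : S₁ → S₂) (φ₂ : S₂ → T) (x : S₁) (c : ℝ≥0∞) (z : ℕ → S₂) (s : T) :
    Prop where
  monotone : Monotone fun n => φ₂ (z n)
  isLUB : IsLUB (Set.range fun n => φ₂ (z n)) s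
  subMul : ∀ n, ∃ x' c', WayBelow x' x ∧ WayBelow c' c ∧ SubMul (z n) (φ₁ x') c'
  supMul : ∀ x' c', WayBelow x' x → WayBelow c' c → ∃ k, ∀ n ≥ k, SupMul (z n) (φ₁ x') c'

theorem exists_exhausts (hdiv : AlmostDivisible φ₁) (hunp : AlmostUnperforated φ₂)
    (h₁ : IsGenCuMorphism φ₁) (h₂ : IsGenCuMorphism φ₂) (x : S₁) (c : ℝ≥0∞) :
    ∃ s z, Exhausts φ₁ φ₂ x c z s := by
  -- `z n` lies between the multiples of index `2n` and `2n + 1`. The unused step from `2n + 1` to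
  -- `2n + 2` is the gap that comparing `z n` with `z (n + 1)` consumes.
  choose z hz hz' using fun n : ℕ => hdiv.exists_subMul_supMul h₁
    (approx_wayBelow x (2 * n)) (approx_wayBelow c (2 * n))
  have mono : Monotone fun n => φ₂ (z n) := monotone_nat_of_le_succ fun n =>
    hunp.map_le_of_subMul h₂.monotone
      ((hz n).mono (h₁.monotone (approx_wayBelow x (2 * n + 1)).le) le_rfl)
      (approx_wayBelow c (2 * n + 1)) (hz' (n + 1))
  obtain ⟨s, hs⟩ := IsCuSemigroup.O1 _ mono
  refine ⟨s, z, mono, hs, fun n => ⟨_, _, approx_wayBelow_self x _, approx_wayBelow_self c _, hz n⟩,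
    fun x' c' hx hc => ?_⟩
  obtain ⟨k, hk⟩ := exists_le_approx hx
  obtain ⟨l, hl⟩ := exists_le_approx hc
  refine ⟨max k l, fun n hn => (hz' n).mono (h₁.monotone (hk.trans (approx_mono x ?_)))
    (hl.trans (approx_mono c ?_))⟩
  · have := (le_max_left k l).trans hn
    omega
  · have := (le_max_right k l).trans hn
    omega

/-- With `Exhausts.le_of_forall`, this characterizes `s` as the supremum of the images of all test
elements, independently of the sequence. -/
theorem Exhausts.le_of_subMul {x : S₁} {c : ℝ≥0∞} {z : ℕ → S₂} {s : T}
    (h : Exhausts φ₁ φ₂ x c z s) (hunp : AlmostUnperforated φ₂) (h₂ : IsGenCuMorphism φ₂)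
    {w : S₂} {x' : S₁} {c' : ℝ≥0∞} (hx : WayBelow x' x) (hc : WayBelow c' c)
    (hw : SubMul w (φ₁ x') c') : φ₂ w ≤ s := by
  obtain ⟨d, hd, hd'⟩ := hc.exists_between
  obtain ⟨k, hk⟩ := h.supMul x' d hx hd'
  exact (hunp.map_le_of_subMul h₂.monotone hw hd (hk k le_rfl)).trans (h.isLUB.1 ⟨k, rfl⟩)

theorem Exhausts.le_of_forall {x : S₁} {c : ℝ≥0∞} {z : ℕ → S₂} {s t : T}
    (h : Exhausts φ₁ φ₂ x c z s)
    (ht : ∀ w x' c', WayBelow x' x → WayBelow c' c → SubMul w (φ₁ x') c' → φ₂ w ≤ t) :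
    s ≤ t := by
  refine h.isLUB.2 ?_
  rintro _ ⟨n, rfl⟩
  obtain ⟨x', c', hx, hc, hn⟩ := h.subMul n
  exact ht _ x' c' hx hc hn

theorem isLUB_map_add {x y : S₁} {c d : ℝ≥0∞} {z w : ℕ → S₂} {s t : T}
    (h : Exhausts φ₁ φ₂ x c z s) (h' : Exhausts φ₁ φ₂ y d w t) (h₂ : IsGenCuMorphism φ₂) :
    IsLUB (Set.range fun n => φ₂ (z n + w n)) (s + t) := by
  simp only [h₂.map_add]
  exact IsCuSemigroup.O4 _ _ _ _ h.monotone h'.monotone h.isLUB h'.isLUB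

variable {Φ : S₁ → ℝ≥0∞ → T} {z : S₁ → ℝ≥0∞ → ℕ → S₂}

theorem isGenCuBimorphism_of_exhausts (hunp : AlmostUnperforated φ₂)
    (h₁ : IsGenCuMorphism φ₁) (h₂ : IsGenCuMorphism φ₂)
    (hz : ∀ x c, Exhausts φ₁ φ₂ x c (z x c) (Φ x c)) : IsGenCuBimorphism Φ := by
  have mono : ∀ x x' c c', x ≤ x' → c ≤ c' → Φ x c ≤ Φ x' c' := by
    intro x x' c c' hx hc
    exact (hz x c).le_of_forall fun w u d hu hd hw =>
      (hz x' c').le_of_subMul hunp h₂ (hu.trans_le hx) (hd.trans_le hc) hw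
  refine ⟨fun c => ?_, fun x => ?_, fun x y c => ?_, fun x c d => ?_, mono, ?_⟩
  · refine le_zero_iff_eq.1 ((hz 0 c).le_of_forall fun w u d hu _ hw => ?_)
    rw [le_zero_iff_eq.1 hu.le, h₁.map_zero] at hw
    rw [hw.eq_zero_of_zero, h₂.map_zero]
  · refine le_zero_iff_eq.1 ((hz x 0).le_of_forall fun w u d _ hd hw => ?_)
    rw [le_zero_iff_eq.1 hd.le] at hw
    rw [hw.eq_zero, h₂.map_zero]
  · have hlub := isLUB_map_add (hz x c) (hz y c) h₂
    apply le_antisymm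
    · refine (hz (x + y) c).le_of_forall fun w u d hu hd hw => ?_
      obtain ⟨x', y', hx, hy, huxy⟩ := exists_add_of_wayBelow_add hu
      -- The gap `d ≪ e` is what almost unperforation needs to compare `w` with the sum of the
      -- substitutes at factor `e`.
      obtain ⟨e, hde, hec⟩ := hd.exists_between
      obtain ⟨k, hk⟩ := (hz x c).supMul x' e hx hec
      obtain ⟨l, hl⟩ := (hz y c).supMul y' e hy hec
      have hsum := (hk (max k l) (le_max_left _ _)).add_left (hl (max k l) (le_max_right _ _))
      rw [← h₁.map_add] at hsum
      exact (hunp.map_le_of_subMul h₂.monotone (hw.mono (h₁.monotone huxy) le_rfl) hde hsum).trans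
        (hlub.1 ⟨_, rfl⟩)
    · refine hlub.2 ?_
      rintro _ ⟨n, rfl⟩
      obtain ⟨x', d, hx, hd, hn⟩ := (hz x c).subMul n
      obtain ⟨y', e, hy, he, hn'⟩ := (hz y c).subMul n
      obtain ⟨e', hde, hee, he'⟩ := exists_common hd he
      have hsum := (hn.mono le_rfl hde).add_left (hn'.mono le_rfl hee)
      rw [← h₁.map_add] at hsum
      exact (hz (x + y) c).le_of_subMul hunp h₂ (IsCuSemigroup.O3 _ _ _ _ hx hy) he' hsum
  · have hlub := isLUB_map_add (hz x c) (hz x d) h₂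
    apply le_antisymm
    · refine (hz x (c + d)).le_of_forall fun w u e hu he hw => ?_
      -- Interpolating before splitting `c + d` leaves `e ≪ c' + d'`, not just `e ≤ c' + d'`.
      obtain ⟨e', hee, hecd⟩ := he.exists_between
      obtain ⟨c', d', hc, hd, hcd⟩ := exists_add_of_wayBelow_add hecd
      obtain ⟨k, hk⟩ := (hz x c).supMul u c' hu hc
      obtain ⟨l, hl⟩ := (hz x d).supMul u d' hu hd
      have hsum := (hk (max k l) (le_max_left _ _)).add_right (hl (max k l) (le_max_right _ _))
      exact (hunp.map_le_of_subMul h₂.monotone hw (hee.trans_le hcd) hsum).trans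
        (hlub.1 ⟨_, rfl⟩)
    · refine hlub.2 ?_
      rintro _ ⟨n, rfl⟩
      obtain ⟨x', c', hx, hc, hn⟩ := (hz x c).subMul n
      obtain ⟨y', d', hy, hd, hn'⟩ := (hz x d).subMul n
      obtain ⟨u, hxu, hyu, hu⟩ := exists_common hx hy
      exact (hz x (c + d)).le_of_subMul hunp h₂ hu (IsCuSemigroup.O3 _ _ _ _ hc hd)
        ((hn.mono (h₁.monotone hxu) le_rfl).add_right (hn'.mono (h₁.monotone hyu) le_rfl))
  · intro u v x c hu hv hx hc
    constructor
    · rintro _ ⟨n, rfl⟩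
      exact mono _ _ _ _ (hx.1 ⟨n, rfl⟩) (hc.1 ⟨n, rfl⟩)
    · intro t ht
      refine (hz x c).le_of_forall fun w x' d hx' hd hw => ?_
      -- `x' ≪ x` alone gives `x' ≤ u k`; interpolation upgrades this to `x' ≪ u k`, so `w` is a
      -- test element at a member of the sequence. The same applies to `d`.
      obtain ⟨x'', hxx, hx''⟩ := hx'.exists_between
      obtain ⟨e, hde, hec⟩ := hd.exists_between
      obtain ⟨k, hk⟩ := hx'' u x hu hx le_rfl
      obtain ⟨l, hl⟩ := hec v c hv hc le_rfl
      exact ((hz _ _).le_of_subMul hunp h₂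
        (hxx.trans_le (hk.trans (hu (le_max_left k l))))
        (hde.trans_le (hl.trans (hv (le_max_right k l)))) hw).trans (ht ⟨max k l, rfl⟩)

/-- Preservation of `≪` by `φ₁` lets a substitute for `(x, c)` shrink to some `w` compactly
contained in it whose image still dominates `Φ x' c'`; preservation by `φ₂` carries this containment
to `T`. -/
theorem wayBelow_of_exhausts (hunp : AlmostUnperforated φ₂)
    (h₁ : IsCuMorphism φ₁) (h₂ : IsCuMorphism φ₂)
    (hz : ∀ x c, Exhausts φ₁ φ₂ x c (z x c) (Φ x c)) (x' x : S₁) (c' c : ℝ≥0∞)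
    (hx : WayBelow x' x) (hc : WayBelow c' c) : WayBelow (Φ x' c') (Φ x c) := by
  obtain ⟨u, hxu, hux⟩ := hx.exists_between
  obtain ⟨k, hk⟩ := (hz x c).supMul u c' hux hc
  obtain ⟨w, hw, hw'⟩ := (hk k le_rfl).exists_wayBelow (h₁.map_wayBelow _ _ hxu)
  have hle : Φ x' c' ≤ φ₂ w := (hz x' c').le_of_forall fun v y d hy hd hv =>
    hunp.map_le_of_subMul h₂.monotone (hv.mono (h₁.monotone hy.le) le_rfl) hd hw'
  exact .le_trans hle ((h₂.map_wayBelow _ _ hw).trans_le ((hz x c).isLUB.1 ⟨k, rfl⟩))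

theorem eq_of_exhausts_one (hsoft : IsSoftMap φ₁) (hunp : AlmostUnperforated φ₂)
    (h₁ : IsGenCuMorphism φ₁) (h₂ : IsGenCuMorphism φ₂) {x : S₁} {z : ℕ → S₂} {s : T}
    (h : Exhausts φ₁ φ₂ x 1 z s) : s = φ₂ (φ₁ x) := by
  apply le_antisymm
  · refine h.le_of_forall fun w x' c hx hc hw => ?_
    refine hunp.map_le_of_subMul h₂.monotone (hw.mono (h₁.monotone hx.le) le_rfl) hc ?_
    -- `φ₁ x` is itself at least `1 · φ₁ x`.
    exact ⟨1, 1, by simp⟩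
  · refine (h₂.map_sup _ _ (approx_mono (φ₁ x)) (approx_isLUB (φ₁ x))).2 ?_
    rintro _ ⟨j, rfl⟩
    -- Softness is applied at index `j + 1`: the spare `≪` down to index `j` then replaces `φ₁ x` by
    -- `φ₁` of some `approx x k`, so that the `j`-th term is at most `n / (n + 1)` times an
    -- admissible element.
    obtain ⟨n, hn⟩ := (hsoft x).exists_nsmul_le (approx_wayBelow_self (φ₁ x) (j + 1))
    have hmono : Monotone fun k => φ₁ (approx x k) := fun i k hik => h₁.monotone (approx_mono x hik)
    obtain ⟨k, hk⟩ := (approx_wayBelow (φ₁ x) j).nsmul (n + 1) _ _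
      (fun i k hik => nsmul_le_nsmul_right (hmono hik) n)
      (isLUB_nsmul hmono (h₁.map_sup _ _ (approx_mono x) (approx_isLUB x)) n) hn
    have hn0 : ((n + 1 : ℕ) : ℝ≥0∞) ≠ 0 := by exact_mod_cast n.succ_ne_zero
    refine h.le_of_subMul hunp h₂ (c' := (n : ℝ≥0∞) / (n + 1 : ℕ)) (approx_wayBelow_self x k)
      (ennreal_wayBelow_of_lt ?_) ⟨n, n + 1, n.succ_pos, ?_, hk⟩
    · rw [ENNReal.div_lt_iff (.inl hn0) (.inl (ENNReal.natCast_ne_top _)), one_mul]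
      exact_mod_cast n.lt_succ_self
    · rw [ENNReal.div_mul_cancel hn0 (ENNReal.natCast_ne_top _)]

end RealBimorphism

end Cu

theorem mainTheorem9 {S₁ S₂ T : Type*}
    [AddCommMonoid S₁] [PartialOrder S₁] [Cu.IsCuSemigroup S₁]
    [AddCommMonoid S₂] [PartialOrder S₂] [Cu.IsCuSemigroup S₂]
    [AddCommMonoid T] [PartialOrder T] [Cu.IsCuSemigroup T]
    (φ₁ : S₁ → S₂) (φ₂ : S₂ → T)
    (hsoft : Cu.IsSoftMap φ₁) (hdiv : Cu.AlmostDivisible φ₁) (hunp : Cu.AlmostUnperforated φ₂) :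
    (Cu.IsGenCuMorphism φ₁ → Cu.IsGenCuMorphism φ₂ →
      ∃ γ : Cu.Tensor S₁ ℝ≥0∞ → T, Cu.IsGenCuMorphism γ ∧
        ∀ x : S₁, γ (Cu.Tensor.pure x 1) = φ₂ (φ₁ x)) ∧
    (Cu.IsCuMorphism φ₁ → Cu.IsCuMorphism φ₂ →
      ∃ γ : Cu.Tensor S₁ ℝ≥0∞ → T, Cu.IsCuMorphism γ ∧
        ∀ x : S₁, γ (Cu.Tensor.pure x 1) = φ₂ (φ₁ x)) := by
  refine ⟨fun h₁ h₂ => ?_, fun h₁ h₂ => ?_⟩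
  · choose Φ z hz using Cu.exists_exhausts hdiv hunp h₁ h₂
    obtain ⟨γ, hγ, hpure, -⟩ := (Cu.isGenCuBimorphism_of_exhausts hunp h₁ h₂ hz).exists_lift
    exact ⟨γ, hγ, fun x =>
      (hpure x 1).trans (Cu.eq_of_exhausts_one hsoft hunp h₁ h₂ (hz x 1))⟩
  · have g₁ := h₁.toIsGenCuMorphism
    have g₂ := h₂.toIsGenCuMorphism
    choose Φ z hz using Cu.exists_exhausts hdiv hunp g₁ g₂
    obtain ⟨γ, hγ, hpure, hwb⟩ := (Cu.isGenCuBimorphism_of_exhausts hunp g₁ g₂ hz).exists_lift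
    exact ⟨γ, ⟨hγ, hwb (Cu.wayBelow_of_exhausts hunp h₁ h₂ hz)⟩, fun x =>
      (hpure x 1).trans (Cu.eq_of_exhausts_one hsoft hunp g₁ g₂ (hz x 1))⟩
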